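/- Conventions. Let $\mathbb{F}$ be a field and let the variables $\mathbf{x}=\mathbf{x}_1\sqcup\cdots\sqcup\mathbf{x}_d$ be partitioned into $d\ge 1$ parts, each consisting of $n$ variables. A polynomial $f\in\mathbb{F}[\mathbf{x}]$ is *set-multilinear* if every monomial of $f$ contains exactly one variable (to the first power) from each part. Its *tensor rank* $\operatorname{TensorRank}(f)$ is the least $r$ such that $f=\sum_{i=1}^{r}\ell_{i1}(\mathbf{x}_1)\cdots\ell_{id}(\mathbf{x}_d)$, where each $\ell_{ij}$ is a linear form in the variables of $\mathbf{x}_j$. An *arithmetic formula* is a rooted tree whose leaves are labelled by variables or field constants and whose inner gates are product gates or sum gates of arbitrary fan-in, where edges into sum gates may carry field constants; its *size* is its number of gates (including leaves). It is *homogeneous* if every gate computes a homogeneous polynomial; it need not be set-multilinear. **Theorem.** There is an absolute constant $K>0$ such that the following holds. Let $c>0$ be a constant and let $d=d(n)\ge 1$ be a function of $n$ with $\log d=o(\log n)$ as $n\to\infty$. Then for all sufficiently large $n$ (depending only on $c$ and on the function $d$), every field $\mathbb{F}$, and every polynomial $f$ over $\mathbb{F}$ that is set-multilinear with respect to $\mathbf{x}=\mathbf{x}_1\sqcup\cdots\sqcup\mathbf{x}_d$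 with $|\mathbf{x}_i|=n$ for all $i$ and that is computed by a homogeneous formula (not necessarily set-multilinear) of size at most $n^c$, we have $$\operatorname{TensorRank}(f)\;\le\;\frac{n^{d}}{n^{d/\exp(Kc)}}.$$ -/

import Mathlib

open Filter Asymptotics

universe u v

/-- Arithmetic formulas over `F` with variables `σ`: rooted trees whose leaves are labelled by
variables or field constants and whose inner gates are sum gates (of arbitrary fan-in `k`, the edge
to the `i`-th child carrying the field constant `w i`) or product gates (of arbitrary fan-in). -/
inductive ArithFormula (F : Type u) (σ : Type v) : Type (max u v)
  | var (x : σ) : ArithFormula F σ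
  | const (a : F) : ArithFormula F σ
  | sum (k : ℕ) (w : Fin k → F) (g : Fin k → ArithFormula F σ) : ArithFormula F σ
  | prod (k : ℕ) (g : Fin k → ArithFormula F σ) : ArithFormula F σ

namespace ArithFormula

variable {F : Type u} {σ : Type v}

/-- The size of a formula: its number of gates (nodes of the tree), leaves included. -/
def size : ArithFormula F σ → ℕ
  | var _ => 1
  | const _ => 1
  | sum _ _ g => 1 + ∑ i, (g i).size
  | prod _ g => 1 + ∑ i, (g i).size

variable [CommSemiring F]

/-- The polynomial computed at the root of a formula. -/
noncomputable def toPoly : ArithFormula F σ → MvPolynomial σ F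
  | var x => MvPolynomial.X x
  | const a => MvPolynomial.C a
  | sum _ w g => ∑ i, MvPolynomial.C (w i) * (g i).toPoly
  | prod _ g => ∏ i, (g i).toPoly

/-- A formula is homogeneous if every gate of it computes a homogeneous polynomial. (Leaves always
do, with degree `1` or `0`.) -/
def IsHomogeneous : ArithFormula F σ → Prop
  | var _ => True
  | const _ => True
  | sum k w g => (∃ e : ℕ, (sum k w g).toPoly.IsHomogeneous e) ∧ ∀ i, (g i).IsHomogeneous
  | prod k g => (∃ e : ℕ, (prod k g).toPoly.IsHomogeneous e) ∧ ∀ i, (g i).IsHomogeneous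

end ArithFormula

section TensorRank

variable {F : Type u} [CommSemiring F] {d n : ℕ}

/-- The variables are `x_(j,k)` with `j : Fin d` and `k : Fin n`; the `j`-th part consists of the
`n` variables `x_(j,k)`. A polynomial is set-multilinear if each of its monomials contains exactly
one variable (with multiplicity) from each part. -/
def IsSetMultilinear (f : MvPolynomial (Fin d × Fin n) F) : Prop :=
  ∀ m ∈ f.support, ∀ j : Fin d, ∑ k : Fin n, m (j, k) = 1

/-- `f` is a sum of `r` set-multilinear products `ℓ_1(x_1) ⋯ ℓ_d(x_d)` of linear forms, where
`ℓ_j` only involves the variables in the `j`-th part. -/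
def HasTensorDecomposition (f : MvPolynomial (Fin d × Fin n) F) (r : ℕ) : Prop :=
  ∃ a : Fin r → Fin d → Fin n → F,
    f = ∑ i : Fin r, ∏ j : Fin d, ∑ k : Fin n,
      MvPolynomial.C (a i j k) * MvPolynomial.X (j, k)

/-- The tensor rank of `f`: the least `r` such that `f` is a sum of `r` set-multilinear products of
linear forms. -/
noncomputable def tensorRank (f : MvPolynomial (Fin d × Fin n) F) : ℕ :=
  sInf {r : ℕ | HasTensorDecomposition f r}

/-- Monomials with exactly one variable from each part have a decomposition with one term. -/
theorem hasTensorDecomposition_monomial (hd : 1 ≤ d) (m : Fin d × Fin n →₀ ℕ) (c : F)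
    (hm : ∀ j : Fin d, ∑ k : Fin n, m (j, k) = 1) :
    HasTensorDecomposition (MvPolynomial.monomial m c) 1 := by
  classical
  have key : ∀ j : Fin d, ∃ k : Fin n, ∀ k', m (j, k') = if k' = k then 1 else 0 := by
    intro j
    obtain ⟨k, -, hk⟩ : ∃ k ∈ Finset.univ, m (j, k) ≠ 0 := by
      apply Finset.exists_ne_zero_of_sum_ne_zero
      rw [hm j]; exact one_ne_zero
    refine ⟨k, fun k' => ?_⟩
    have h := hm j
    rw [← Finset.add_sum_erase _ _ (Finset.mem_univ k)] at h
    by_cases hk' : k' = k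
    · subst hk'; simp; omega
    · have h0 : ∑ x ∈ Finset.univ.erase k, m (j, x) = 0 := by omega
      simpa [hk'] using Finset.sum_eq_zero_iff.mp h0 k' (by simp [hk'])
  choose κ hκ using key
  let z : Fin d := ⟨0, hd⟩
  refine ⟨fun _ j k => if k = κ j then (if j = z then c else 1) else 0, ?_⟩
  have h1 : ∀ j : Fin d, (∑ k : Fin n,
      MvPolynomial.C (if k = κ j then (if j = z then c else 1) else 0) *
        MvPolynomial.X (R := F) (j, k))
      = MvPolynomial.C (if j = z then c else 1) * MvPolynomial.X (j, κ j) := by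
    intro j
    rw [Finset.sum_eq_single (κ j)]
    · simp
    · intro b _ hb; simp [hb]
    · simp
  have hX : ∏ j : Fin d, MvPolynomial.X (R := F) (j, κ j) = MvPolynomial.monomial m 1 := by
    rw [MvPolynomial.monomial_eq, Finsupp.prod_fintype _ _ (by simp), Fintype.prod_prod_type]
    simp [hκ, pow_ite]
  simp only [Finset.univ_unique, Finset.sum_singleton, h1, Finset.prod_mul_distrib, hX]
  rw [← map_prod, Finset.prod_ite_eq' Finset.univ z (fun _ => c)]
  simp [MvPolynomial.C_mul_monomial]

/-- For `d ≥ 1` the minimum in the definition of the tensor rank of a set-multilinear polynomial is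
taken over a nonempty set, hence it is attained. -/
theorem IsSetMultilinear.hasTensorDecomposition_tensorRank (hd : 1 ≤ d)
    {f : MvPolynomial (Fin d × Fin n) F} (hf : IsSetMultilinear f) :
    HasTensorDecomposition f (tensorRank f) := by
  classical
  refine Nat.sInf_mem (s := {r : ℕ | HasTensorDecomposition f r}) ?_
  have h : ∀ m ∈ f.support, HasTensorDecomposition (MvPolynomial.monomial m (f.coeff m)) 1 :=
    fun m hm => hasTensorDecomposition_monomial hd m _ (hf m hm)
  rw [MvPolynomial.as_sum f]
  generalize f.support = s at h
  induction s using Finset.induction_on with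
  | empty => exact ⟨0, Fin.elim0, by simp⟩
  | insert m s hms ih =>
    obtain ⟨r, a, ha⟩ := ih fun m' hm' => h m' (Finset.mem_insert_of_mem hm')
    obtain ⟨b, hb⟩ := h m (Finset.mem_insert_self _ _)
    refine ⟨1 + r, Fin.append b a, ?_⟩
    rw [Finset.sum_insert hms, ha, hb, Fin.sum_univ_add]
    simp

end TensorRank

/-!
Descend in a homogeneous formula of size `s`, at each product gate into a child of largest degree,
and expand the sum gates met on the way. This writes the polynomial, of degree `e` say, as a sum of
at most `s` products of at least `log₂ e` factors of positive degree: passing a product gate with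
`N` other nonconstant children gains `N` factors, and divides the degree by at most
`N + 1 ≤ 2 ^ N`. The factors are again computed by homogeneous formulas of size at most `s`, so the
expansion can be repeated on a factor of degree greater than `2 ^ q`. After `k` rounds, where
`k * q * 2 ^ q ≤ d`, a polynomial of degree `d` is a sum of `s ^ k` products of at least `k * q`
factors.

The factors need not be set-multilinear, but only the set-multilinear part of each product matters.
The `d` parts can be distributed over the factors in at most `d ^ d` ways, and a factor of degree
`e` contributes rank at most `n ^ (e - 1)`, so a product of `m` factors contributes at most
`d ^ d * n ^ (d - m)`. For `q ≥ 2 * c` the gain `n ^ (k * q)` outweighs `s ^ k ≤ n ^ (c * k)`, while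
`d ^ d` is `n ^ o(d)`. If `c < 1 / 2`, it suffices that a formula of size `n ^ c` involves at most
`n ^ c` variables.
-/

/-- `x` is a sum of at most `r` elements of `S`; for `S` the tensors of rank one, this says that
`x` has rank at most `r`. -/
def IsSumOf {M : Type*} [AddMonoid M] (S : Set M) (r : ℕ) (x : M) : Prop :=
  ∃ l : List M, (∀ y ∈ l, y ∈ S) ∧ l.sum = x ∧ l.length ≤ r

namespace IsSumOf

section AddMonoid

variable {M : Type*} [AddMonoid M] {S S' : Set M} {r r' : ℕ} {x y : M}

theorem zero : IsSumOf S r (0 : M) :=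
  ⟨[], by simp⟩

theorem of_mem (hx : x ∈ S) : IsSumOf S 1 x :=
  ⟨[x], by simpa using hx⟩

theorem mono (h : IsSumOf S r x) (hr : r ≤ r') : IsSumOf S r' x :=
  let ⟨l, hl, hsum, hlen⟩ := h
  ⟨l, hl, hsum, hlen.trans hr⟩

theorem add (hx : IsSumOf S r x) (hy : IsSumOf S r' y) : IsSumOf S (r + r') (x + y) := by
  obtain ⟨l, hl, rfl, hlen⟩ := hx
  obtain ⟨l', hl', rfl, hlen'⟩ := hy
  refine ⟨l ++ l', fun z hz => ?_, List.sum_append, ?_⟩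
  · exact (List.mem_append.1 hz).elim (hl z) (hl' z)
  · simpa using Nat.add_le_add hlen hlen'

theorem map {N G : Type*} [AddMonoid N] [FunLike G M N] [AddMonoidHomClass G M N] {S' : Set N}
    (φ : G) (h : IsSumOf S r x) (hφ : Set.MapsTo φ S S') : IsSumOf S' r (φ x) := by
  obtain ⟨l, hl, rfl, hlen⟩ := h
  refine ⟨l.map φ, ?_, (map_list_sum φ l).symm, by simpa using hlen⟩
  simpa using fun y hy => hφ (hl y hy)

theorem trans (h : IsSumOf S r x) (hS : ∀ y ∈ S, IsSumOf S' r' y) : IsSumOf S' (r * r') x := by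
  obtain ⟨l, hl, rfl, hlen⟩ := h
  refine mono ?_ (Nat.mul_le_mul_right r' hlen)
  clear hlen
  induction l with
  | nil => exact zero
  | cons y l ih =>
    rw [List.sum_cons, List.length_cons, add_mul, one_mul, add_comm (l.length * r')]
    exact (hS y (hl y List.mem_cons_self)).add (ih fun z hz => hl z (List.mem_cons_of_mem y hz))

end AddMonoid

theorem sum {M ι : Type*} [AddCommMonoid M] {S : Set M} {s : Finset ι} {x : ι → M} {r : ι → ℕ}
    (h : ∀ i ∈ s, IsSumOf S (r i) (x i)) : IsSumOf S (∑ i ∈ s, r i) (∑ i ∈ s, x i) := by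
  classical
  induction s using Finset.induction_on with
  | empty => exact zero
  | insert i s hi ih =>
    rw [Finset.sum_insert hi, Finset.sum_insert hi]
    exact (h i (Finset.mem_insert_self i s)).add
      (ih fun j hj => h j (Finset.mem_insert_of_mem hj))

theorem mul {R : Type*} [NonUnitalNonAssocSemiring R] {S S' S'' : Set R} {r r' : ℕ} {x y : R}
    (hx : IsSumOf S r x) (hy : IsSumOf S' r' y) (h : ∀ a ∈ S, ∀ b ∈ S', a * b ∈ S'') :
    IsSumOf S'' (r * r') (x * y) := by
  refine (hx.map (S' := (· * y) '' S) (AddMonoidHom.mulRight y)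
    (Set.mapsTo_image _ _)).trans ?_
  rintro _ ⟨a, ha, rfl⟩
  exact hy.map (AddMonoidHom.mulLeft a) (h a ha)

end IsSumOf

section FactorProducts

variable {R σ : Type*} [CommSemiring R]

/-- Scalar multiples of products of at least `m` polynomials from `S`, all of them of positive
degree, whose degrees add up to `e`. -/
def factorProducts (S : Set (MvPolynomial σ R)) (e m : ℕ) : Set (MvPolynomial σ R) :=
  {p | ∃ (b : R) (L : Multiset (MvPolynomial σ R)),
    (∀ g ∈ L, g ∈ S ∧ 0 < g.totalDegree) ∧ (L.map MvPolynomial.totalDegree).sum = e ∧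
      m ≤ Multiset.card L ∧ p = b • L.prod}

variable {S : Set (MvPolynomial σ R)} {p p' : MvPolynomial σ R} {e e' m m' : ℕ}

theorem factorProducts_mono (hm : m' ≤ m) : factorProducts S e m ⊆ factorProducts S e m' :=
  fun _ ⟨b, L, hL, hdeg, hcard, hp⟩ => ⟨b, L, hL, hdeg, hm.trans hcard, hp⟩

theorem C_mem_factorProducts (b : R) : MvPolynomial.C b ∈ factorProducts S 0 0 :=
  ⟨b, 0, by simp [MvPolynomial.smul_eq_C_mul]⟩

theorem smul_mem_factorProducts (b : R) (hp : p ∈ factorProducts S e m) :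
    b • p ∈ factorProducts S e m := by
  obtain ⟨b', L, hL, hdeg, hcard, rfl⟩ := hp
  exact ⟨b * b', L, hL, hdeg, hcard, smul_smul b b' L.prod⟩

theorem mul_mem_factorProducts (hp : p ∈ factorProducts S e m) (hp' : p' ∈ factorProducts S e' m') :
    p * p' ∈ factorProducts S (e + e') (m + m') := by
  obtain ⟨b, L, hL, rfl, hcard, rfl⟩ := hp
  obtain ⟨b', L', hL', rfl, hcard', rfl⟩ := hp'
  refine ⟨b * b', L + L', fun g hg => ?_, by simp, ?_, ?_⟩
  · exact (Multiset.mem_add.1 hg).elim (hL g) (hL' g)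
  · simpa using Nat.add_le_add hcard hcard'
  · rw [Multiset.prod_add, smul_mul_smul_comm]

theorem prod_mem_factorProducts {ι : Type*} {s : Finset ι} {g : ι → MvPolynomial σ R}
    {e m : ι → ℕ} (h : ∀ i ∈ s, g i ∈ factorProducts S (e i) (m i)) :
    ∏ i ∈ s, g i ∈ factorProducts S (∑ i ∈ s, e i) (∑ i ∈ s, m i) := by
  classical
  induction s using Finset.induction_on with
  | empty => simpa using C_mem_factorProducts (S := S) (1 : R)
  | insert i s hi ih =>
    rw [Finset.prod_insert hi, Finset.sum_insert hi, Finset.sum_insert hi]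
    exact mul_mem_factorProducts (h i (Finset.mem_insert_self i s))
      (ih fun j hj => h j (Finset.mem_insert_of_mem hj))

theorem mem_factorProducts_of_mem (hp : p ∈ S) :
    p ∈ factorProducts S p.totalDegree (min 1 p.totalDegree) := by
  rcases Nat.eq_zero_or_pos p.totalDegree with hdeg | hdeg
  · rw [hdeg, MvPolynomial.totalDegree_eq_zero_iff_eq_C.1 hdeg]
    exact C_mem_factorProducts _
  · exact ⟨1, {p}, by simp [hp, hdeg]⟩

/-- Each round replaces a factor of degree greater than `2 ^ q`, of which there is one as long as
there are fewer than `(k + 1) * q` factors, by more than `q` new ones. -/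
theorem isSumOf_factorProducts_iterate {s d q k : ℕ} (hs : 0 < s)
    (hS : ∀ g ∈ S, 0 < g.totalDegree →
      IsSumOf (factorProducts S g.totalDegree (Nat.clog 2 g.totalDegree)) s g)
    (hp : p ∈ factorProducts S d 0) (hk : k * q * 2 ^ q ≤ d) :
    IsSumOf (factorProducts S d (k * q)) (s ^ k) p := by
  induction k with
  | zero => simpa using IsSumOf.of_mem hp
  | succ k ih =>
    rw [pow_succ]
    refine (ih (le_trans (by gcongr; omega) hk)).trans ?_
    rintro _ ⟨b, L, hL, hdeg, hcard, rfl⟩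
    by_cases hdone : (k + 1) * q ≤ Multiset.card L
    · refine IsSumOf.mono (IsSumOf.of_mem ?_) hs
      exact ⟨b, L, hL, hdeg, hdone, rfl⟩
    obtain ⟨g, hg, hgq⟩ : ∃ g ∈ L, 2 ^ q < g.totalDegree := by
      by_contra! hsmall
      have hle : d ≤ Multiset.card L * 2 ^ q := by
        simpa [hdeg] using Multiset.sum_le_card_nsmul (L.map MvPolynomial.totalDegree) (2 ^ q)
          (by simpa using hsmall)
      have hlt : Multiset.card L * 2 ^ q < (k + 1) * q * 2 ^ q := by
        gcongr
        omega
      omega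
    obtain ⟨L, rfl⟩ := Multiset.exists_cons_of_mem hg
    have hrest : b • L.prod ∈ factorProducts S (L.map MvPolynomial.totalDegree).sum
        (Multiset.card L) :=
      ⟨b, L, fun g' hg' => hL g' (Multiset.mem_cons_of_mem hg'), rfl, le_rfl, rfl⟩
    have hgain : (k + 1) * q ≤ Nat.clog 2 g.totalDegree + Multiset.card L := by
      have := (Nat.lt_clog_iff_pow_lt one_lt_two).2 hgq
      rw [Multiset.card_cons] at hcard
      linarith
    rw [Multiset.map_cons, Multiset.sum_cons] at hdeg
    rw [Multiset.prod_cons, ← mul_smul_comm]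
    exact (hS g (hL g hg).1 (hL g hg).2).map (AddMonoidHom.mulRight (b • L.prod)) fun p hp =>
      hdeg ▸ factorProducts_mono hgain (mul_mem_factorProducts hp hrest)

end FactorProducts

namespace ArithFormula

section Size

variable {R σ : Type*}

theorem size_pos (Φ : ArithFormula R σ) : 0 < Φ.size := by
  cases Φ <;> simp [size]

theorem size_le_sum_size {k : ℕ} (g : Fin k → ArithFormula R σ) (i : Fin k) :
    (g i).size ≤ ∑ i, (g i).size :=
  Finset.single_le_sum (f := fun i => (g i).size) (fun _ _ => Nat.zero_le _) (Finset.mem_univ i)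

end Size

variable {R σ : Type*} [CommSemiring R]

theorem card_vars_toPoly_le_size (Φ : ArithFormula R σ) : Φ.toPoly.vars.card ≤ Φ.size := by
  classical
  induction Φ with
  | var x =>
    rcases subsingleton_or_nontrivial R with _ | _
    · simp [toPoly, size, Subsingleton.elim (MvPolynomial.X (R := R) x) 0]
    · simp [toPoly, size]
  | const a => simp [toPoly, size]
  | sum k w g ih =>
    have hsub : (sum k w g).toPoly.vars ⊆ Finset.univ.biUnion fun i => (g i).toPoly.vars :=
      (MvPolynomial.vars_sum_subset _ _).trans
        (Finset.biUnion_mono fun i _ => (MvPolynomial.vars_mul _ _).trans (by simp))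
    calc _ ≤ ∑ i, (g i).toPoly.vars.card := (Finset.card_le_card hsub).trans Finset.card_biUnion_le
      _ ≤ ∑ i, (g i).size := Finset.sum_le_sum fun i _ => ih i
      _ ≤ _ := Nat.le_add_left _ _
  | prod k g ih =>
    calc _ ≤ ∑ i, (g i).toPoly.vars.card :=
          (Finset.card_le_card (MvPolynomial.vars_prod _)).trans Finset.card_biUnion_le
      _ ≤ ∑ i, (g i).size := Finset.sum_le_sum fun i _ => ih i
      _ ≤ _ := Nat.le_add_left _ _

theorem IsHomogeneous.exists_isHomogeneous_toPoly {Φ : ArithFormula R σ} (h : Φ.IsHomogeneous) :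
    ∃ e, Φ.toPoly.IsHomogeneous e := by
  cases Φ with
  | var x => exact ⟨1, MvPolynomial.isHomogeneous_X R x⟩
  | const a => exact ⟨0, MvPolynomial.isHomogeneous_C σ a⟩
  | sum k w g => exact h.1
  | prod k g => exact h.1

theorem IsHomogeneous.isHomogeneous_totalDegree {Φ : ArithFormula R σ} (h : Φ.IsHomogeneous) :
    Φ.toPoly.IsHomogeneous Φ.toPoly.totalDegree := by
  obtain ⟨e, he⟩ := h.exists_isHomogeneous_toPoly
  by_cases h0 : Φ.toPoly = 0
  · rw [h0]
    exact MvPolynomial.isHomogeneous_zero _ _ _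
  · rwa [he.totalDegree h0]

/-- The polynomials computed by homogeneous formulas of size at most `s`. -/
def homogeneouslyComputable (R σ : Type*) [CommSemiring R] (s : ℕ) : Set (MvPolynomial σ R) :=
  {p | ∃ Φ : ArithFormula R σ, Φ.IsHomogeneous ∧ Φ.size ≤ s ∧ Φ.toPoly = p}

variable {s : ℕ}

theorem isHomogeneous_totalDegree_of_mem_homogeneouslyComputable {p : MvPolynomial σ R}
    (hp : p ∈ homogeneouslyComputable R σ s) : p.IsHomogeneous p.totalDegree := by
  obtain ⟨Φ, hΦ, -, rfl⟩ := hp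
  exact hΦ.isHomogeneous_totalDegree

theorem isSumOf_factorProducts_of_totalDegree_le_one {Φ : ArithFormula R σ} {e : ℕ}
    (hΦ : Φ.IsHomogeneous) (hs : Φ.size ≤ s) (he : Φ.toPoly.IsHomogeneous e)
    (hdeg : Φ.toPoly.totalDegree ≤ 1) :
    IsSumOf (factorProducts (homogeneouslyComputable R σ s) e (Nat.clog 2 e)) Φ.size Φ.toPoly := by
  by_cases h0 : Φ.toPoly = 0
  · rw [h0]
    exact IsSumOf.zero
  obtain rfl := he.totalDegree h0
  refine (IsSumOf.of_mem ?_).mono Φ.size_pos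
  refine factorProducts_mono ?_ (mem_factorProducts_of_mem ⟨Φ, hΦ, hs, rfl⟩)
  rw [Nat.clog_of_right_le_one hdeg]
  exact Nat.zero_le _

theorem isSumOf_factorProducts_sum {k : ℕ} {w : Fin k → R} {g : Fin k → ArithFormula R σ}
    {S : Set (MvPolynomial σ R)} {e m : ℕ} (hg : ∀ i, (g i).IsHomogeneous)
    (he : (sum k w g).toPoly.IsHomogeneous e)
    (h : ∀ i, (g i).toPoly.IsHomogeneous e →
      IsSumOf (factorProducts S e m) (g i).size (g i).toPoly) :
    IsSumOf (factorProducts S e m) (sum k w g).size (sum k w g).toPoly := by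
  have hcomponent : (sum k w g).toPoly =
      ∑ i, w i • MvPolynomial.homogeneousComponent e (g i).toPoly := by
    conv_lhs => rw [← MvPolynomial.homogeneousComponent_eq_self he]
    simp only [toPoly, map_sum, MvPolynomial.homogeneousComponent_C_mul,
      MvPolynomial.smul_eq_C_mul]
  rw [hcomponent]
  refine (IsSumOf.sum (r := fun i => (g i).size) fun i _ => ?_).mono (Nat.le_add_left _ _)
  obtain ⟨e', he'⟩ := (hg i).exists_isHomogeneous_toPoly
  rw [MvPolynomial.homogeneousComponent_of_mem he']
  split_ifs with hee
  · exact (h i (hee ▸ he')).map (DistribSMul.toAddMonoidHom _ (w i)) fun p hp =>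
      smul_mem_factorProducts (w i) hp
  · rw [smul_zero]
    exact IsSumOf.zero

theorem isSumOf_factorProducts_prod {k : ℕ} {g : Fin k → ArithFormula R σ}
    {e : ℕ} (he0 : 0 < e) (hg : ∀ i, (g i).IsHomogeneous) (hs : ∀ i, (g i).size ≤ s)
    (he : (prod k g).toPoly.IsHomogeneous e) (h0 : (prod k g).toPoly ≠ 0)
    (h : ∀ i e', 0 < e' → (g i).toPoly.IsHomogeneous e' →
      IsSumOf (factorProducts (homogeneouslyComputable R σ s) e' (Nat.clog 2 e')) (g i).size
        (g i).toPoly) :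
    IsSumOf (factorProducts (homogeneouslyComputable R σ s) e (Nat.clog 2 e)) (prod k g).size
      (prod k g).toPoly := by
  set δ : Fin k → ℕ := fun i => (g i).toPoly.totalDegree
  have hδ : ∀ i, (g i).toPoly.IsHomogeneous (δ i) := fun i => (hg i).isHomogeneous_totalDegree
  have hsum : ∑ i, δ i = e :=
    (MvPolynomial.IsHomogeneous.prod Finset.univ _ δ fun i _ => hδ i).inj_right he h0
  obtain ⟨i₁, -, hi₁⟩ : ∃ i ∈ Finset.univ, δ i ≠ 0 :=
    Finset.exists_ne_zero_of_sum_ne_zero (by omega)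
  obtain ⟨i₀, -, hmax⟩ := Finset.univ.exists_max_image δ ⟨i₁, Finset.mem_univ i₁⟩
  have hpos : 0 < δ i₀ := (Nat.pos_of_ne_zero hi₁).trans_le (hmax i₁ (Finset.mem_univ i₁))
  set N := ∑ i ∈ Finset.univ.erase i₀, min 1 (δ i)
  have hothers : ∏ i ∈ Finset.univ.erase i₀, (g i).toPoly ∈
      factorProducts (homogeneouslyComputable R σ s) (∑ i ∈ Finset.univ.erase i₀, δ i) N :=
    prod_mem_factorProducts fun i _ => mem_factorProducts_of_mem ⟨g i, hg i, hs i, rfl⟩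
  have hle : e ≤ (N + 1) * δ i₀ := by
    rw [← hsum, ← Finset.sum_erase_add _ _ (Finset.mem_univ i₀), add_mul, one_mul, Finset.sum_mul]
    gcongr with i
    rcases Nat.eq_zero_or_pos (δ i) with hi | hi
    · simp [hi]
    · simpa [Nat.min_eq_left (Nat.succ_le_of_lt hi)] using hmax i (Finset.mem_univ i)
  have hclog : Nat.clog 2 e ≤ N + Nat.clog 2 (δ i₀) := by
    refine Nat.clog_le_of_le_pow (hle.trans ?_)
    rw [pow_add]
    exact Nat.mul_le_mul Nat.lt_two_pow_self (Nat.le_pow_clog one_lt_two _)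
  rw [toPoly, ← Finset.prod_erase_mul _ _ (Finset.mem_univ i₀)]
  refine ((h i₀ (δ i₀) hpos (hδ i₀)).map (AddMonoidHom.mulLeft _) fun p hp => ?_).mono
    ((size_le_sum_size g i₀).trans (Nat.le_add_left _ _))
  rw [← hsum, ← Finset.sum_erase_add _ _ (Finset.mem_univ i₀)] at hclog ⊢
  exact factorProducts_mono hclog (mul_mem_factorProducts hothers hp)

theorem isSumOf_factorProducts (Φ : ArithFormula R σ) {e : ℕ} (he0 : 0 < e)
    (hΦ : Φ.IsHomogeneous) (hs : Φ.size ≤ s) (he : Φ.toPoly.IsHomogeneous e) :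
    IsSumOf (factorProducts (homogeneouslyComputable R σ s) e (Nat.clog 2 e)) Φ.size
      Φ.toPoly := by
  induction Φ generalizing e with
  | var x =>
    exact isSumOf_factorProducts_of_totalDegree_le_one hΦ hs he
      (MvPolynomial.isHomogeneous_X R x).totalDegree_le
  | const a =>
    exact isSumOf_factorProducts_of_totalDegree_le_one hΦ hs he
      (by simp [toPoly])
  | sum k w g ih =>
    have hgs : ∀ i, (g i).size ≤ s := fun i =>
      (size_le_sum_size g i).trans ((Nat.le_add_left _ _).trans hs)
    exact isSumOf_factorProducts_sum hΦ.2 he fun i => ih i he0 (hΦ.2 i) (hgs i)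
  | prod k g ih =>
    have hgs : ∀ i, (g i).size ≤ s := fun i =>
      (size_le_sum_size g i).trans ((Nat.le_add_left _ _).trans hs)
    by_cases h0 : (prod k g).toPoly = 0
    · rw [h0]
      exact IsSumOf.zero
    · exact isSumOf_factorProducts_prod he0 hΦ.2 hgs he h0 fun i _ he' =>
        ih i he' (hΦ.2 i) (hgs i)

theorem isSumOf_factorProducts_pow {Φ : ArithFormula R σ} (hΦ : Φ.IsHomogeneous) {d q k : ℕ}
    (hd : Φ.toPoly.IsHomogeneous d) (hk : k * q * 2 ^ q ≤ d) :
    IsSumOf (factorProducts (homogeneouslyComputable R σ Φ.size) d (k * q)) (Φ.size ^ k)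
      Φ.toPoly := by
  by_cases h0 : Φ.toPoly = 0
  · rw [h0]
    exact IsSumOf.zero
  obtain rfl := hd.totalDegree h0
  refine isSumOf_factorProducts_iterate Φ.size_pos ?_ ?_ hk
  · rintro _ ⟨Ψ, hΨ, hs, rfl⟩ hpos
    exact (Ψ.isSumOf_factorProducts hpos hΨ hs hΨ.isHomogeneous_totalDegree).mono hs
  · exact factorProducts_mono (Nat.zero_le _) (mem_factorProducts_of_mem ⟨Φ, hΦ, le_rfl, rfl⟩)

end ArithFormula

section PureTensors

variable {ι α R : Type*} [CommSemiring R] {A B : Finset ι} {T T' : (ι → α) → R}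

/-- The tensors `⊗_{j ∈ A} a j`, encoded as functions of a multi-index `κ : ι → α` of which only the
coordinates in `A` matter. -/
def pureTensors (R α : Type*) {ι : Type*} [CommSemiring R] (A : Finset ι) : Set ((ι → α) → R) :=
  {T | ∃ a : ι → α → R, ∀ κ, T κ = ∏ j ∈ A, a j (κ j)}

theorem mem_pureTensors_singleton {j : ι} (hT : DependsOn T {j}) : T ∈ pureTensors R α {j} := by
  refine ⟨fun _ x => T fun _ => x, fun κ => ?_⟩
  rw [Finset.prod_singleton]
  exact hT (by simp)

theorem mul_mem_pureTensors [DecidableEq ι] (hAB : Disjoint A B) (hT : T ∈ pureTensors R α A)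
    (hT' : T' ∈ pureTensors R α B) : T * T' ∈ pureTensors R α (A ∪ B) := by
  obtain ⟨a, ha⟩ := hT
  obtain ⟨b, hb⟩ := hT'
  refine ⟨A.piecewise a b, fun κ => ?_⟩
  rw [Pi.mul_apply, ha, hb, Finset.prod_union hAB]
  congr 1
  · exact Finset.prod_congr rfl fun j hj => by rw [Finset.piecewise_eq_of_mem _ _ _ hj]
  · exact Finset.prod_congr rfl fun j hj => by
      rw [Finset.piecewise_eq_of_notMem _ _ _ (Finset.disjoint_right.1 hAB hj)]

theorem smul_mem_pureTensors (hA : A.Nonempty) (b : R) (hT : T ∈ pureTensors R α A) :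
    b • T ∈ pureTensors R α A := by
  classical
  obtain ⟨a, ha⟩ := hT
  obtain ⟨j, hj⟩ := hA
  refine ⟨fun i x => (if i = j then b else 1) * a i x, fun κ => ?_⟩
  rw [Finset.prod_mul_distrib, Finset.prod_ite_eq' A j, if_pos hj, Pi.smul_apply, smul_eq_mul, ha]

/-- Slicing `T` along every coordinate of `A` other than `j₀` leaves functions of `κ j₀`. -/
theorem isSumOf_pureTensors_of_dependsOn_insert [DecidableEq ι] {j₀ : ι} (hj₀ : j₀ ∉ A)
    (hT : DependsOn T (insert j₀ A : Finset ι)) (V : ι → Finset α)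
    (hV : ∀ κ, T κ ≠ 0 → ∀ j ∈ A, κ j ∈ V j) :
    IsSumOf (pureTensors R α (insert j₀ A)) (∏ j ∈ A, (V j).card) T := by
  classical
  induction A using Finset.induction_on generalizing T with
  | empty =>
    rw [Finset.prod_empty]
    exact IsSumOf.of_mem (mem_pureTensors_singleton (by simpa using hT))
  | insert j A hj ih =>
    rw [Finset.mem_insert, not_or] at hj₀
    have hslices : T = ∑ x ∈ V j,
        (fun κ => if κ j = x then 1 else 0) * fun κ => T (Function.update κ j x) := by
      funext κ
      have hzero : κ j ∉ V j → T κ = 0 := fun hκ =>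
        not_not.1 fun h0 => hκ (hV κ h0 j (Finset.mem_insert_self j A))
      simpa [Finset.sum_apply] using hzero
    have hslice : ∀ x, IsSumOf (pureTensors R α (insert j₀ A)) (∏ j ∈ A, (V j).card)
        fun κ => T (Function.update κ j x) := by
      refine fun x => ih hj₀.2 (fun κ κ' h => hT fun i hi => ?_) fun κ hκ i hi => ?_
      · rcases eq_or_ne i j with rfl | hij
        · simp
        · simpa [hij] using h i (by simpa [hij] using hi)
      · simpa [ne_of_mem_of_not_mem hi hj] using hV _ hκ i (Finset.mem_insert_of_mem hi)
    have hindicator : ∀ x, (fun κ : ι → α => if κ j = x then (1 : R) else 0) ∈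
        pureTensors R α {j} := fun x =>
      mem_pureTensors_singleton fun κ κ' h => by rw [h j rfl]
    have hdisj : Disjoint {j} (insert j₀ A) := by
      simpa [Ne.symm hj₀.1] using hj
    rw [hslices, Finset.prod_insert hj, ← smul_eq_mul, ← Finset.sum_const, Finset.insert_comm]
    refine IsSumOf.sum fun x _ => ?_
    rw [← one_mul (∏ j ∈ A, (V j).card)]
    exact (IsSumOf.of_mem (hindicator x)).mul (hslice x) fun a ha b hb =>
      mul_mem_pureTensors hdisj ha hb

theorem isSumOf_pureTensors_of_dependsOn [Fintype α] (hA : A.Nonempty) (hT : DependsOn T A) :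
    IsSumOf (pureTensors R α A) (Fintype.card α ^ (A.card - 1)) T := by
  classical
  obtain ⟨j₀, hj₀⟩ := hA
  rw [← Finset.insert_erase hj₀] at hT ⊢
  simpa using isSumOf_pureTensors_of_dependsOn_insert (Finset.notMem_erase j₀ A) hT
    (fun _ => Finset.univ) (by simp)

end PureTensors

section CoeffTensor

variable {ι α R σ : Type*} [CommSemiring R]

theorem coeff_sum_single_mul [DecidableEq σ] (G : Finset σ) (p q : MvPolynomial σ R) :
    (p * q).coeff (∑ x ∈ G, Finsupp.single x 1) = ∑ B ∈ G.powerset,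
      p.coeff (∑ x ∈ B, Finsupp.single x 1) * q.coeff (∑ x ∈ G \ B, Finsupp.single x 1) := by
  set e : Finset σ → σ →₀ ℕ := fun B => ∑ x ∈ B, Finsupp.single x 1
  have he : ∀ B x, e B x = if x ∈ B then 1 else 0 := by
    simp [e, Finsupp.finsetSum_apply, Finsupp.single_apply]
  have hsplit : ∀ B ⊆ G, e B + e (G \ B) = e G := fun B hB => by
    rw [add_comm, Finset.sum_sdiff hB]
  have hsupport : ∀ B, (e B).support = B := fun B => by
    ext x
    simp [he]
  rw [MvPolynomial.coeff_mul]
  refine (Finset.sum_bij (fun B _ => (e B, e (G \ B))) ?_ ?_ ?_ fun _ _ => rfl).symm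
  · intro B hB
    exact Finset.HasAntidiagonal.mem_antidiagonal.2 (hsplit B (Finset.mem_powerset.1 hB))
  · intro B _ B' _ h
    have hB : e B = e B' := (Prod.ext_iff.1 h).1
    rw [← hsupport B, hB, hsupport]
  · rintro ⟨u, v⟩ huv
    replace huv : u + v = e G := Finset.HasAntidiagonal.mem_antidiagonal.1 huv
    have hle : ∀ x, u x ≤ if x ∈ G then 1 else 0 := fun x => by
      rw [← he, ← huv]
      exact Nat.le_add_right _ _
    have hsub : u.support ⊆ G := fun x hx => by
      by_contra hxG
      simpa [hxG, Finsupp.mem_support_iff.1 hx] using hle x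
    have hu : e u.support = u := by
      ext x
      have := (hle x).trans (ite_le_one le_rfl zero_le_one)
      rw [he]
      split_ifs with hx <;> rw [Finsupp.mem_support_iff] at hx <;> omega
    refine ⟨u.support, Finset.mem_powerset.2 hsub, Prod.ext hu ?_⟩
    exact add_left_cancel (a := u) (by rw [huv, ← hsplit u.support hsub, hu])

/-- The tensor of the coefficients in `p` of the monomials `∏ j ∈ A, X (j, κ j)`, which are the
set-multilinear monomials in the parts indexed by `A`. -/
noncomputable def coeffTensor (A : Finset ι) : MvPolynomial (ι × α) R →ₗ[R] ((ι → α) → R) :=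
  LinearMap.pi fun κ => MvPolynomial.lcoeff R (∑ j ∈ A, Finsupp.single (j, κ j) 1)

theorem coeffTensor_apply (A : Finset ι) (p : MvPolynomial (ι × α) R) (κ : ι → α) :
    coeffTensor A p κ = p.coeff (∑ j ∈ A, Finsupp.single (j, κ j) 1) :=
  rfl

theorem dependsOn_coeffTensor (A : Finset ι) (p : MvPolynomial (ι × α) R) :
    DependsOn (coeffTensor A p) A := fun κ κ' h => by
  rw [coeffTensor_apply, coeffTensor_apply,
    Finset.sum_congr rfl fun j hj => by rw [h j (Finset.mem_coe.2 hj)]]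

theorem coeffTensor_eq_zero_of_isHomogeneous {A : Finset ι} {p : MvPolynomial (ι × α) R} {e : ℕ}
    (hp : p.IsHomogeneous e) (he : A.card ≠ e) : coeffTensor A p = 0 :=
  funext fun κ => hp.coeff_eq_zero (by simpa [map_sum, Finsupp.degree_single] using he)

theorem isSumOf_coeffTensor_one (A : Finset ι) :
    IsSumOf (pureTensors R α A) 1 (coeffTensor A 1) := by
  rcases A.eq_empty_or_nonempty with rfl | hA
  · exact IsSumOf.of_mem ⟨0, fun κ => by simp [coeffTensor_apply]⟩
  · rw [coeffTensor_eq_zero_of_isHomogeneous (MvPolynomial.isHomogeneous_one _ _) hA.card_ne_zero]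
    exact IsSumOf.zero

theorem coeffTensor_mul [DecidableEq ι] (A : Finset ι) (p q : MvPolynomial (ι × α) R) :
    coeffTensor A (p * q) = ∑ B ∈ A.powerset, coeffTensor B p * coeffTensor (A \ B) q := by
  classical
  funext κ
  have hinj : Function.Injective fun j => (j, κ j) := fun _ _ h => (Prod.ext_iff.1 h).1
  have himage : ∀ B : Finset ι, ∑ j ∈ B, Finsupp.single (j, κ j) 1 =
      ∑ x ∈ B.image fun j => (j, κ j), Finsupp.single x 1 := fun B =>
    (Finset.sum_image (f := fun x => Finsupp.single x 1) hinj.injOn).symm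
  simp only [Finset.sum_apply, Pi.mul_apply, coeffTensor_apply, himage, coeff_sum_single_mul,
    Finset.powerset_image, Finset.image_sdiff _ _ hinj]
  exact Finset.sum_image (Finset.image_injective hinj).injOn

theorem coeffTensor_mul_of_isHomogeneous [DecidableEq ι] (A : Finset ι)
    {p : MvPolynomial (ι × α) R} {e : ℕ} (hp : p.IsHomogeneous e) (q : MvPolynomial (ι × α) R) :
    coeffTensor A (p * q) = ∑ B ∈ A.powersetCard e, coeffTensor B p * coeffTensor (A \ B) q := by
  rw [coeffTensor_mul]
  refine (Finset.sum_subset (fun B hB => ?_) fun B hB hBe => ?_).symm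
  · exact Finset.mem_powerset.2 (Finset.mem_powersetCard.1 hB).1
  · rw [coeffTensor_eq_zero_of_isHomogeneous hp, zero_mul]
    exact fun he => hBe (Finset.mem_powersetCard.2 ⟨Finset.mem_powerset.1 hB, he⟩)

theorem isSumOf_coeffTensor_prod [Fintype ι] [Fintype α] {L : Multiset (MvPolynomial (ι × α) R)}
    (hL : ∀ p ∈ L, p.IsHomogeneous p.totalDegree ∧ 0 < p.totalDegree) (A : Finset ι) :
    IsSumOf (pureTensors R α A)
      (Fintype.card ι ^ (L.map MvPolynomial.totalDegree).sum *
        Fintype.card α ^ ((L.map MvPolynomial.totalDegree).sum - Multiset.card L))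
      (coeffTensor A L.prod) := by
  classical
  induction L using Multiset.induction_on generalizing A with
  | empty =>
    simpa using isSumOf_coeffTensor_one A
  | cons p L ih =>
    rw [Multiset.forall_mem_cons] at hL
    obtain ⟨⟨hp, hpos⟩, hL⟩ := hL
    specialize ih hL
    have hcard : Multiset.card L ≤ (L.map MvPolynomial.totalDegree).sum := by
      simpa using Multiset.card_nsmul_le_sum (s := L.map MvPolynomial.totalDegree) (a := 1)
        (by simpa using fun p hp => Nat.succ_le_of_lt (hL p hp).2)
    have hterm : ∀ B ∈ A.powersetCard p.totalDegree, IsSumOf (pureTensors R α A) _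
        (coeffTensor B p * coeffTensor (A \ B) L.prod) := fun B hB => by
      obtain ⟨hBA, hBcard⟩ := Finset.mem_powersetCard.1 hB
      have hslice := isSumOf_pureTensors_of_dependsOn
        (Finset.card_pos.1 (hBcard.symm ▸ hpos)) (dependsOn_coeffTensor B p)
      rw [hBcard] at hslice
      refine hslice.mul (ih (A \ B)) fun T hT T' hT' => ?_
      exact Finset.union_sdiff_of_subset hBA ▸ mul_mem_pureTensors Finset.disjoint_sdiff hT hT'
    have hchoose : A.card.choose p.totalDegree ≤ Fintype.card ι ^ p.totalDegree :=
      (Nat.choose_le_pow _ _).trans (Nat.pow_le_pow_left A.card_le_univ _)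
    rw [Multiset.prod_cons, coeffTensor_mul_of_isHomogeneous A hp, Multiset.map_cons,
      Multiset.sum_cons, Multiset.card_cons, add_comm (Multiset.card L),
      ← tsub_add_tsub_comm hpos hcard, pow_add, pow_add, mul_mul_mul_comm, mul_assoc]
    refine (IsSumOf.sum hterm).mono ?_
    rw [Finset.sum_const, Finset.card_powersetCard, smul_eq_mul]
    refine (Nat.mul_le_mul_right _ hchoose).trans_eq ?_
    ring

end CoeffTensor

theorem isSumOf_coeffTensor_of_mem_factorProducts {ι α R : Type*} [CommSemiring R] [Fintype ι]
    [Fintype α] [Nonempty α] {S : Set (MvPolynomial (ι × α) R)} {e m : ℕ} {A : Finset ι}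
    {p : MvPolynomial (ι × α) R} (hA : A.Nonempty) (hS : ∀ g ∈ S, g.IsHomogeneous g.totalDegree)
    (hp : p ∈ factorProducts S e m) :
    IsSumOf (pureTensors R α A) (Fintype.card ι ^ e * Fintype.card α ^ (e - m))
      (coeffTensor A p) := by
  obtain ⟨b, L, hL, rfl, hcard, rfl⟩ := hp
  rw [map_smul]
  refine ((isSumOf_coeffTensor_prod (fun g hg => ⟨hS g (hL g hg).1, (hL g hg).2⟩) A).map
    (DistribSMul.toAddMonoidHom _ b) fun T hT => smul_mem_pureTensors hA b hT).mono ?_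
  gcongr
  exact Fintype.card_pos

section Transversals

variable {ι α : Type*} [Fintype ι] [Fintype α]

theorem exists_eq_sum_single_of_sum_eq_one {m : ι × α →₀ ℕ} (hm : ∀ j, ∑ k, m (j, k) = 1) :
    ∃ κ : ι → α, m = ∑ j, Finsupp.single (j, κ j) 1 := by
  classical
  have hsingle : ∀ j, ∃ k, m.curry j = Finsupp.single k 1 := fun j =>
    ((m.curry j).sum_eq_one_iff).1 (by rw [Finsupp.sum_fintype _ _ fun _ => rfl]; exact hm j)
  choose κ hκ using hsingle
  refine ⟨κ, Finsupp.ext fun ⟨j, k⟩ => ?_⟩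
  rw [← Finsupp.curry_apply, hκ]
  simp [Finsupp.finsetSum_apply, Finsupp.single_apply, ite_and]

theorem prod_sum_C_mul_X [DecidableEq ι] {R : Type*} [CommSemiring R] (a : ι → α → R) :
    ∏ j, ∑ k, MvPolynomial.C (a j k) * MvPolynomial.X (j, k) =
      ∑ κ : ι → α, MvPolynomial.monomial (∑ j, Finsupp.single (j, κ j) 1)
        (∏ j, a j (κ j)) := by
  rw [Finset.prod_univ_sum, Fintype.piFinset_univ]
  refine Finset.sum_congr rfl fun κ _ => ?_
  rw [MvPolynomial.monomial_sum_index, map_prod, Finset.prod_mul_distrib]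
  rfl

end Transversals

section SetMultilinear

variable {R : Type*} [CommSemiring R] {d n : ℕ} {f : MvPolynomial (Fin d × Fin n) R}

theorem IsSetMultilinear.eq_sum_monomial_coeffTensor (hf : IsSetMultilinear f) :
    f = ∑ κ : Fin d → Fin n, MvPolynomial.monomial (∑ j, Finsupp.single (j, κ j) 1)
      (coeffTensor Finset.univ f κ) := by
  classical
  have hinj : Function.Injective fun κ : Fin d → Fin n =>
      ∑ j, Finsupp.single (j, κ j) 1 := fun κ κ' h => by
    funext j
    have := DFunLike.congr_fun h (j, κ' j)
    simpa [Finsupp.finsetSum_apply, Finsupp.single_apply, ite_and] using this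
  have hsupport : f.support ⊆ Finset.univ.image fun κ : Fin d → Fin n =>
      ∑ j, Finsupp.single (j, κ j) 1 := fun m hm => by
    obtain ⟨κ, rfl⟩ := exists_eq_sum_single_of_sum_eq_one (hf m hm)
    exact Finset.mem_image_of_mem _ (Finset.mem_univ κ)
  conv_lhs => rw [f.as_sum, Finset.sum_subset hsupport fun m _ hm => by
    rw [MvPolynomial.notMem_support_iff.1 hm, map_zero], Finset.sum_image hinj.injOn]
  rfl

theorem IsSetMultilinear.isHomogeneous (hf : IsSetMultilinear f) : f.IsHomogeneous d := by
  rw [hf.eq_sum_monomial_coeffTensor]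
  exact MvPolynomial.IsHomogeneous.sum _ _ _ fun κ _ =>
    MvPolynomial.isHomogeneous_monomial _ (by simp [map_sum, Finsupp.degree_single])

theorem tensorRank_le_of_isSumOf {r : ℕ} (hf : IsSetMultilinear f)
    (h : IsSumOf (pureTensors R (Fin n) Finset.univ) r (coeffTensor Finset.univ f)) :
    tensorRank f ≤ r := by
  obtain ⟨l, hl, hsum, hlen⟩ := h
  choose a ha using fun i : Fin l.length => hl _ (l.get_mem i)
  have hdecomp : f = ∑ i, ∏ j, ∑ k, MvPolynomial.C (a i j k) * MvPolynomial.X (j, k) := by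
    rw [hf.eq_sum_monomial_coeffTensor, ← hsum, ← Fin.sum_univ_getElem]
    simp only [Finset.sum_apply, map_sum, prod_sum_C_mul_X, ← ha, List.get_eq_getElem]
    exact Finset.sum_comm
  exact le_trans (Nat.sInf_le (s := {r | HasTensorDecomposition f r}) ⟨a, hdecomp⟩) hlen

theorem tensorRank_le_pow_pred (hd : 0 < d) (hf : IsSetMultilinear f) :
    tensorRank f ≤ n ^ (d - 1) := by
  refine tensorRank_le_of_isSumOf hf ?_
  simpa using isSumOf_pureTensors_of_dependsOn ⟨⟨0, hd⟩, Finset.mem_univ _⟩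
    (dependsOn_coeffTensor Finset.univ f)

theorem tensorRank_le_card_vars_pow_pred (hd : 0 < d) (hf : IsSetMultilinear f) :
    tensorRank f ≤ f.vars.card ^ (d - 1) := by
  classical
  set V : Fin d → Finset (Fin n) := fun j => {k | (j, k) ∈ f.vars}
  have hV : ∀ κ, coeffTensor Finset.univ f κ ≠ 0 → ∀ j, κ j ∈ V j := fun κ hκ j => by
    rw [Finset.mem_filter_univ, MvPolynomial.mem_vars_iff_mem_support]
    exact ⟨_, MvPolynomial.mem_support_iff.2 hκ, by
      simp [Finsupp.finsetSum_apply, Finsupp.single_apply]⟩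
  have hcard : ∀ j, (V j).card ≤ f.vars.card := fun j =>
    Finset.card_le_card_of_injOn (fun k => (j, k)) (fun k hk => by simpa [V] using hk)
      (Prod.mk_right_injective j).injOn
  have hsum := isSumOf_pureTensors_of_dependsOn_insert
    (Finset.notMem_erase (⟨0, hd⟩ : Fin d) Finset.univ)
    (by simpa using dependsOn_coeffTensor Finset.univ f) V fun κ hκ j _ => hV κ hκ j
  rw [Finset.insert_erase (Finset.mem_univ _)] at hsum
  refine (tensorRank_le_of_isSumOf hf hsum).trans ?_
  simpa using Finset.prod_le_pow_card (Finset.univ.erase ⟨0, hd⟩) _ _ fun j _ => hcard j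

theorem tensorRank_toPoly_le_size_pow {Φ : ArithFormula R (Fin d × Fin n)} (hd : 0 < d)
    (hf : IsSetMultilinear Φ.toPoly) : tensorRank Φ.toPoly ≤ Φ.size ^ d :=
  calc tensorRank Φ.toPoly ≤ Φ.toPoly.vars.card ^ (d - 1) := tensorRank_le_card_vars_pow_pred hd hf
    _ ≤ Φ.size ^ (d - 1) := Nat.pow_le_pow_left Φ.card_vars_toPoly_le_size _
    _ ≤ Φ.size ^ d := Nat.pow_le_pow_right Φ.size_pos (Nat.sub_le d 1)

theorem tensorRank_toPoly_le_size_pow_mul {Φ : ArithFormula R (Fin d × Fin n)} {q k : ℕ}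
    (hd : 0 < d) (hn : 0 < n) (hf : IsSetMultilinear Φ.toPoly) (hΦ : Φ.IsHomogeneous)
    (hk : k * q * 2 ^ q ≤ d) :
    tensorRank Φ.toPoly ≤ Φ.size ^ k * (d ^ d * n ^ (d - k * q)) := by
  have : Nonempty (Fin n) := ⟨⟨0, hn⟩⟩
  have hcoeff := (ArithFormula.isSumOf_factorProducts_pow hΦ hf.isHomogeneous hk).map
    (coeffTensor Finset.univ) (Set.mapsTo_image _ _)
  refine tensorRank_le_of_isSumOf hf (hcoeff.trans ?_)
  rintro _ ⟨p, hp, rfl⟩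
  simpa using isSumOf_coeffTensor_of_mem_factorProducts ⟨⟨0, hd⟩, Finset.mem_univ _⟩
    (fun _ => ArithFormula.isHomogeneous_totalDegree_of_mem_homogeneouslyComputable) hp

end SetMultilinear

section RealBounds

variable {c : ℝ}

theorem le_one_sub_inv_exp_of_lt_half (hc : 0 < c) (hc' : c < 1 / 2) :
    c ≤ 1 - (Real.exp (20 * c))⁻¹ := by
  have hinv : (Real.exp (20 * c))⁻¹ ≤ (20 * c + 1)⁻¹ := by
    gcongr
    exact Real.add_one_le_exp _
  have hlinear : (20 * c + 1)⁻¹ ≤ 1 - c := by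
    rw [inv_le_iff_one_le_mul₀ (by linarith)]
    nlinarith
  linarith

theorem exists_nat_mul_two_pow_le_exp (hc : 1 / 2 ≤ c) :
    ∃ q : ℕ, 2 * c ≤ q ∧ q * 2 ^ q ≤ Real.exp (20 * c) ∧ 8 * 2 ^ q ≤ Real.exp (20 * c) := by
  obtain ⟨q, hq, hq'⟩ : ∃ q : ℕ, 2 * c ≤ q ∧ (q : ℝ) ≤ 4 * c :=
    ⟨⌈2 * c⌉₊, Nat.le_ceil _, by linarith [Nat.ceil_lt_add_one (by linarith : 0 ≤ 2 * c)]⟩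
  have hpow : (2 : ℝ) ^ q ≤ Real.exp (4 * c) :=
    calc (2 : ℝ) ^ q ≤ Real.exp 1 ^ q := by
          gcongr
          linarith [Real.add_one_le_exp 1]
      _ = Real.exp q := by rw [← Real.exp_nat_mul, mul_one]
      _ ≤ Real.exp (4 * c) := Real.exp_le_exp.2 hq'
  have hmul : ∀ x ≤ 16 * c, x * 2 ^ q ≤ Real.exp (20 * c) := fun x hx =>
    calc x * 2 ^ q ≤ Real.exp (16 * c) * Real.exp (4 * c) := by
          gcongr
          linarith [Real.add_one_le_exp (16 * c)]
      _ = Real.exp (20 * c) := by rw [← Real.exp_add]; ring_nf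
  exact ⟨q, hq, hmul q (by linarith), hmul 8 (by linarith)⟩

theorem exists_mul_le_and_le_two_mul {m d : ℕ} (hm : 0 < m) (hmd : m ≤ d) :
    ∃ k, k * m ≤ d ∧ d ≤ 2 * (k * m) := by
  have hlt : d < d / m * m + m := Nat.lt_div_mul_add hm
  have hle : m ≤ d / m * m := Nat.le_mul_of_pos_left m (Nat.div_pos hmd hm)
  exact ⟨d / m, Nat.div_mul_le_self d m, by omega⟩

theorem mul_add_inv_mul_add_sub_le {E : ℝ} {d q k : ℕ} (hq : 2 * c ≤ q) (hE : 8 * 2 ^ q ≤ E)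
    (hk : d ≤ 2 * (k * q * 2 ^ q)) : c * k + E⁻¹ * d + (d - k * q) ≤ d - d / E := by
  have hE0 : 0 < E := lt_of_lt_of_le (by positivity) hE
  have hdE : d / E ≤ k * q / 4 := by
    rw [div_le_iff₀ hE0]
    calc (d : ℝ) ≤ 2 * (k * q * 2 ^ q) := by exact_mod_cast hk
      _ = k * q / 4 * (8 * 2 ^ q) := by ring
      _ ≤ k * q / 4 * E := by gcongr
  have hck : c * k ≤ k * q / 2 := by
    linarith [mul_le_mul_of_nonneg_right hq k.cast_nonneg]
  rw [inv_mul_eq_div]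
  linarith

theorem eventually_le_rpow_of_isLittleO_log {α : Type*} {l : Filter α} {f g : α → ℝ} {ε : ℝ}
    (hfg : (fun x => Real.log (f x)) =o[l] fun x => Real.log (g x)) (hg : ∀ᶠ x in l, 1 ≤ g x)
    (hε : 0 < ε) : ∀ᶠ x in l, f x ≤ g x ^ ε := by
  filter_upwards [hfg.def hε, hg] with x hlog hgx
  refine Real.le_rpow_of_log_le (zero_lt_one.trans_le hgx) ?_
  rw [Real.norm_of_nonneg (Real.log_nonneg hgx)] at hlog
  exact (Real.le_norm_self _).trans hlog

end RealBounds

section RealTensorRank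

variable {R : Type*} [CommSemiring R] {d n : ℕ} {c : ℝ} {Φ : ArithFormula R (Fin d × Fin n)}

theorem tensorRank_toPoly_le_rpow_mul (hd : 0 < d) (hf : IsSetMultilinear Φ.toPoly)
    (hs : (Φ.size : ℝ) ≤ (n : ℝ) ^ c) : (tensorRank Φ.toPoly : ℝ) ≤ (n : ℝ) ^ (c * d) :=
  calc (tensorRank Φ.toPoly : ℝ) ≤ (Φ.size : ℝ) ^ d := by
        exact_mod_cast tensorRank_toPoly_le_size_pow hd hf
    _ ≤ ((n : ℝ) ^ c) ^ d := by gcongr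
    _ = (n : ℝ) ^ (c * d) := (Real.rpow_mul_natCast n.cast_nonneg c d).symm

theorem tensorRank_toPoly_le_rpow_add {q k : ℕ} {ε : ℝ} (hd : 0 < d) (hn : 0 < n)
    (hf : IsSetMultilinear Φ.toPoly) (hΦ : Φ.IsHomogeneous) (hs : (Φ.size : ℝ) ≤ (n : ℝ) ^ c)
    (hdn : (d : ℝ) ≤ (n : ℝ) ^ ε) (hk : k * q * 2 ^ q ≤ d) :
    (tensorRank Φ.toPoly : ℝ) ≤ (n : ℝ) ^ (c * k + ε * d + (d - k * q)) := by
  have hkq : k * q ≤ d := (Nat.le_mul_of_pos_right _ (by positivity)).trans hk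
  calc (tensorRank Φ.toPoly : ℝ) ≤ Φ.size ^ k * (d ^ d * n ^ (d - k * q)) := by
        exact_mod_cast tensorRank_toPoly_le_size_pow_mul hd hn hf hΦ hk
    _ ≤ ((n : ℝ) ^ c) ^ k * (((n : ℝ) ^ ε) ^ d * n ^ (d - k * q)) := by gcongr
    _ = (n : ℝ) ^ (c * k) * ((n : ℝ) ^ (ε * d) * (n : ℝ) ^ ((d : ℝ) - k * q)) := by
        rw [← Real.rpow_mul_natCast n.cast_nonneg, ← Real.rpow_mul_natCast n.cast_nonneg,
          ← Real.rpow_natCast _ (d - k * q), Nat.cast_sub hkq, Nat.cast_mul]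
    _ = (n : ℝ) ^ (c * k + ε * d + (d - k * q)) := by
        rw [← Real.rpow_add (by exact_mod_cast hn), ← Real.rpow_add (by exact_mod_cast hn),
          add_assoc]

theorem exists_tensorRank_toPoly_le_rpow_of_half_le (hd : 0 < d) (hn : 0 < n) (hc : 1 / 2 ≤ c)
    (hdn : (d : ℝ) ≤ (n : ℝ) ^ (Real.exp (20 * c))⁻¹) (hf : IsSetMultilinear Φ.toPoly)
    (hΦ : Φ.IsHomogeneous) (hs : (Φ.size : ℝ) ≤ (n : ℝ) ^ c) :
    ∃ y : ℝ, tensorRank Φ.toPoly ≤ (n : ℝ) ^ y ∧ y ≤ d - d / Real.exp (20 * c) := by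
  obtain ⟨q, hq, hqE, hE⟩ := exists_nat_mul_two_pow_le_exp hc
  have hq0 : 0 < q := by
    rw [← Nat.cast_pos (α := ℝ)]
    linarith
  rcases lt_or_ge d (q * 2 ^ q) with hdq | hdq
  · have hdE : (d : ℝ) ≤ Real.exp (20 * c) := le_trans (by exact_mod_cast hdq.le) hqE
    refine ⟨(d - 1 : ℕ), ?_, ?_⟩
    · exact_mod_cast tensorRank_le_pow_pred hd hf
    · rw [Nat.cast_sub hd, Nat.cast_one]
      linarith [(div_le_one (Real.exp_pos (20 * c))).2 hdE]
  · obtain ⟨k, hk, hk'⟩ := exists_mul_le_and_le_two_mul (by positivity) hdq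
    rw [← mul_assoc] at hk
    exact ⟨_, tensorRank_toPoly_le_rpow_add hd hn hf hΦ hs hdn hk,
      mul_add_inv_mul_add_sub_le hq hE (by rwa [mul_assoc k])⟩

end RealTensorRank

theorem mainTheorem5_general {R : Type*} [CommSemiring R] {d n : ℕ} {c : ℝ} (hd : 1 ≤ d)
    (hc : 0 < c) (hdn : (d : ℝ) ≤ (n : ℝ) ^ (Real.exp (20 * c))⁻¹)
    {Φ : ArithFormula R (Fin d × Fin n)} (hf : IsSetMultilinear Φ.toPoly) (hΦ : Φ.IsHomogeneous)
    (hs : (Φ.size : ℝ) ≤ (n : ℝ) ^ c) :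
    (tensorRank Φ.toPoly : ℝ) ≤ (n : ℝ) ^ d / (n : ℝ) ^ ((d : ℝ) / Real.exp (20 * c)) := by
  set E := Real.exp (20 * c)
  have hn : 0 < n := Nat.pos_of_ne_zero fun hn0 => by
    rw [hn0, Nat.cast_zero, Real.zero_rpow (inv_ne_zero (Real.exp_ne_zero _))] at hdn
    exact hd.not_gt (by exact_mod_cast hdn.trans_lt one_pos)
  obtain ⟨y, hrank, hy⟩ : ∃ y : ℝ, tensorRank Φ.toPoly ≤ (n : ℝ) ^ y ∧ y ≤ d - d / E := by
    rcases lt_or_ge c (1 / 2) with hc2 | hc2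
    · refine ⟨c * d, tensorRank_toPoly_le_rpow_mul hd hf hs, ?_⟩
      calc c * d ≤ (1 - E⁻¹) * d := by gcongr; exact le_one_sub_inv_exp_of_lt_half hc hc2
        _ = d - d / E := by ring
    · exact exists_tensorRank_toPoly_le_rpow_of_half_le hd hn hc2 hdn hf hΦ hs
  rw [← Real.rpow_natCast, ← Real.rpow_sub (by exact_mod_cast hn)]
  exact hrank.trans (Real.rpow_le_rpow_of_exponent_le (by exact_mod_cast hn) hy)

theorem mainTheorem5 :
    ∃ K : ℝ, 0 < K ∧
      ∀ c : ℝ, 0 < c →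
      ∀ d : ℕ → ℕ, (∀ n, 1 ≤ d n) →
        (fun n : ℕ => Real.log (d n : ℝ)) =o[atTop] (fun n : ℕ => Real.log (n : ℝ)) →
      ∀ᶠ n : ℕ in atTop,
        ∀ (F : Type u) [Field F] (f : MvPolynomial (Fin (d n) × Fin n) F)
          (Φ : ArithFormula F (Fin (d n) × Fin n)),
          IsSetMultilinear f →
          Φ.IsHomogeneous →
          Φ.toPoly = f →
          (Φ.size : ℝ) ≤ (n : ℝ) ^ c →
          (tensorRank f : ℝ) ≤ (n : ℝ) ^ (d n) / (n : ℝ) ^ ((d n : ℝ) / Real.exp (K * c)) := by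
  refine ⟨20, by norm_num, fun c hc d hd hlog => ?_⟩
  have hcast : ∀ᶠ n : ℕ in atTop, (1 : ℝ) ≤ n := by
    filter_upwards [eventually_ge_atTop 1] with n hn using by exact_mod_cast hn
  filter_upwards [eventually_le_rpow_of_isLittleO_log hlog hcast
    (inv_pos.2 (Real.exp_pos (20 * c)))] with n hdn F _ f Φ hf hΦ hΦf hs
  subst hΦf
  exact mainTheorem5_general (hd n) hc hdn hf hΦ hs
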